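/- Let $R$ be a commutative ring that is complete and Hausdorff for a linear topology (for example a discrete ring), let $S=\mathrm{Spf}(R)$, and let $\mathbb{G}$ be a commutative one-dimensional formal group over $S$ with a coordinate $x$, so that $\mathcal{O}_{\mathbb{G}}=R[[x]]$. A divisor of degree $d$ on $\mathbb{G}$ over $S$ is a closed subscheme $D\subseteq\mathbb{G}$ with $\mathcal{O}_D=R[[x]]/f_D(x)$, where $f_D(x)=x^d+\sum_{i<d}a_ix^i$ and every $a_i$ is topologically nilpotent. Let $D$ be such a divisor and let $k\ge 0$. Let $\mathrm{Sub}_k(D)$ be the scheme over $S$ of divisors $D'\le D$ of degree $k$. Explicitly, $\mathcal{O}_{\mathrm{Sub}_k(D)}=R[c_0,\dots,c_{k-1}]/I$, where $I$ is the smallest ideal modulo which $x^k+\sum_{i<k}c_ix^i$ divides $f_D(x)$. Let $D'$ be the tautological divisor of degree $k$ over $\mathrm{Sub}_k(D)$, with equation $f_{D'}(x)=x^k+\sum_{i<k}c_ix^i$ and $\mathcal{O}_{D'}=\mathcal{O}_{\mathrm{Sub}_k(D)}[[x]]/f_{D'}(x)$. The natural map $\mathcal{O}_D\to\mathcal{O}_{D'}$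 induces an $R$-linear map $$\phi\colon \Lambda^k_{R}\,\mathcal{O}_D\longrightarrow \Lambda^k_{\mathcal{O}_{\mathrm{Sub}_k(D)}}\mathcal{O}_{D'},\qquad a_0\wedge\dots\wedge a_{k-1}\mapsto a_0\wedge\dots\wedge a_{k-1}.$$ Let $\mu_k\colon \mathcal{O}_D^{\otimes k}\to\Lambda^k_R\mathcal{O}_D$ be the projection. Let $x_j$ be the coordinate of the $j$-th tensor factor, let $J_k\subseteq\mathcal{O}_D^{\otimes k}$ be the smallest ideal modulo which $\prod_{j<k}(t-x_j)$ divides $f_D(t)$, and let $q\colon\mathcal{O}_{\mathrm{Sub}_k(D)}\to\mathcal{O}_D^{\otimes k}/J_k$ be the $R$-algebra map that sends $f_{D'}(t)$ to $\prod_{j<k}(t-x_j)$. Then there is exactly one $\mathcal{O}_{\mathrm{Sub}_k(D)}$-module structure on the abelian group $\Lambda^k_R\mathcal{O}_D$ such that $u\cdot\mu_k(b)=\mu_k(sb)$ for all $b\in\mathcal{O}_D^{\otimes k}$ whenever $u\in\mathcal{O}_{\mathrm{Sub}_k(D)}$ and the $\Sigma_k$-invariant element $s\in\mathcal{O}_D^{\otimes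 k}$ satisfy $q(u)=s \bmod J_k$. For this module structure, $\phi$ is an isomorphism of $\mathcal{O}_{\mathrm{Sub}_k(D)}$-modules, and both $\Lambda^k_R\mathcal{O}_D$ and $\Lambda^k_{\mathcal{O}_{\mathrm{Sub}_k(D)}}\mathcal{O}_{D'}$ are free of rank one over $\mathcal{O}_{\mathrm{Sub}_k(D)}$. -/

import Mathlib

open scoped Polynomial PowerSeries TensorProduct Topology

noncomputable section

namespace SubDiv

open Polynomial

/-! ### Monic polynomials with prescribed lower coefficients -/

/-- The monic polynomial `x ^ d + ∑_{i < d} a_i x ^ i`. -/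
def monicPoly {A : Type*} [CommRing A] {d : ℕ} (a : Fin d → A) : A[X] :=
  X ^ d + ∑ i : Fin d, C (a i) * X ^ (i : ℕ)

section monicPoly

variable {A B : Type*} [CommRing A] [CommRing B] {d k : ℕ}

theorem degree_lower_lt (a : Fin d → A) :
    (∑ i : Fin d, C (a i) * X ^ (i : ℕ)).degree < (d : WithBot ℕ) := by
  refine (degree_sum_le _ _).trans_lt ?_
  refine (Finset.sup_lt_iff (WithBot.bot_lt_coe d)).2 fun i _ => ?_
  exact (degree_C_mul_X_pow_le _ _).trans_lt (WithBot.coe_lt_coe.2 i.2)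

theorem monic_monicPoly (a : Fin d → A) : (monicPoly a).Monic :=
  monic_X_pow_add (degree_lower_lt a)

theorem coeff_monicPoly (a : Fin d → A) (i : Fin d) : (monicPoly a).coeff i = a i := by
  have h : ¬ ((i : ℕ) = d) := i.2.ne
  simp only [monicPoly, coeff_add, coeff_X_pow, h, if_false, zero_add, finsetSum_coeff,
    coeff_C_mul, mul_ite, mul_one, mul_zero]
  rw [Finset.sum_eq_single i]
  · simp
  · intro j _ hj
    rw [if_neg]
    exact fun h => hj (Fin.ext h.symm)
  · simp

theorem natDegree_monicPoly [Nontrivial A] (a : Fin d → A) : (monicPoly a).natDegree = d := by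
  refine natDegree_eq_of_degree_eq_some ?_
  rw [monicPoly, degree_add_eq_left_of_degree_lt] <;> rw [degree_X_pow]
  exact degree_lower_lt a

theorem map_monicPoly (g : A →+* B) (a : Fin d → A) :
    (monicPoly a).map g = monicPoly fun i => g (a i) := by
  simp [monicPoly, Polynomial.map_sum]

theorem monicPoly_coeff_eq {p : A[X]} (hp : p.Monic) (hd : p.natDegree = k) :
    (monicPoly fun i : Fin k => p.coeff i) = p := by
  subst hd
  conv_rhs => rw [hp.as_sum]
  rw [monicPoly, Finset.sum_range fun i => C (p.coeff i) * X ^ i]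

theorem isNilpotent_coeff_of_dvd {a : Fin d → A} {b : Fin k → A} (ha : ∀ i, IsNilpotent (a i))
    (h : monicPoly b ∣ monicPoly a) (i : Fin k) : IsNilpotent (b i) := by
  rw [nilpotent_iff_mem_prime]
  intro p hp
  have hX : (monicPoly a).map (Ideal.Quotient.mk p) = X ^ d := by
    have h0 : ∀ j, Ideal.Quotient.mk p (a j) = 0 := fun j =>
      Ideal.Quotient.eq_zero_iff_mem.2 (nilpotent_iff_mem_prime.1 (ha j) p hp)
    rw [map_monicPoly]
    simp [monicPoly, h0]
  have hdvd := Polynomial.map_dvd (Ideal.Quotient.mk p) h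
  rw [hX] at hdvd
  obtain ⟨j, -, hj⟩ := (dvd_prime_pow prime_X d).1 hdvd
  have hmon : ((monicPoly b).map (Ideal.Quotient.mk p)).Monic := (monic_monicPoly b).map _
  have heq := eq_of_monic_of_associated hmon (monic_X_pow j) hj
  rw [map_monicPoly] at heq
  have hjk : k = j := by
    have := congrArg natDegree heq
    rwa [natDegree_monicPoly, natDegree_X_pow] at this
  have hc := congrArg (fun q => coeff q (i : ℕ)) heq
  simp only [coeff_monicPoly, coeff_X_pow] at hc
  rw [if_neg (by have := i.2; omega)] at hc
  exact Ideal.Quotient.eq_zero_iff_mem.1 hc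

/-- If the lower coefficients of the monic polynomial `f'` are nilpotent, divisibility by `f'` of a
polynomial is the same in the polynomial ring and in the power series ring. -/
theorem dvd_of_coe_dvd {b : Fin k → A} (hb : ∀ i, IsNilpotent (b i)) {g : A[X]}
    (h : (monicPoly b : A⟦X⟧) ∣ (g : A⟦X⟧)) : monicPoly b ∣ g := by
  obtain ⟨q, hq⟩ := h
  have hnil : IsNilpotent (∑ i : Fin k, C (b i) * X ^ (i : ℕ) : A[X]) := by
    refine isNilpotent_sum fun i _ => ?_
    exact (Commute.all _ _).isNilpotent_mul_right ((hb i).map C)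
  obtain ⟨M, hM⟩ := hnil
  have hu : monicPoly b ∣ (X : A[X]) ^ (k * M) := by
    have h1 : monicPoly b ∣ (X ^ k) ^ M - (-∑ i : Fin k, C (b i) * X ^ (i : ℕ) : A[X]) ^ M := by
      refine dvd_trans (dvd_of_eq ?_) (sub_dvd_pow_sub_pow _ _ M)
      rw [monicPoly, sub_neg_eq_add]
    rwa [neg_pow, hM, mul_zero, sub_zero, ← pow_mul] at h1
  obtain ⟨u, hu⟩ := hu
  set N := k * M with hN
  obtain ⟨q₁, hq₁⟩ : (PowerSeries.X : A⟦X⟧) ^ N ∣ q - (PowerSeries.trunc N q : A[X]) := by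
    rw [PowerSeries.X_pow_dvd_iff]
    intro m hm
    simp [PowerSeries.coeff_trunc, hm]
  set q₀ := PowerSeries.trunc N q
  have e1 : ((g - q₀ * monicPoly b : A[X]) : A⟦X⟧)
      = PowerSeries.X ^ N * (q₁ * (monicPoly b : A⟦X⟧)) := by
    have : q = (q₀ : A⟦X⟧) + PowerSeries.X ^ N * q₁ := by rw [← hq₁]; ring
    rw [Polynomial.coe_sub, Polynomial.coe_mul, hq]
    nth_rewrite 1 [this]
    ring
  obtain ⟨p, hp⟩ : (X : A[X]) ^ N ∣ g - q₀ * monicPoly b := by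
    rw [Polynomial.X_pow_dvd_iff]
    intro m hm
    have := (PowerSeries.X_pow_dvd_iff (φ := ((g - q₀ * monicPoly b : A[X]) : A⟦X⟧))).1
      ⟨_, e1⟩ m hm
    simpa only [Polynomial.coeff_coe] using this
  refine ⟨q₀ + u * p, ?_⟩
  rw [hu] at hp
  linear_combination hp

end monicPoly

/-! ### Divisors on a formal group -/

/-- A divisor of degree `d` on the formal group `G` over `S = Spf R` (with its coordinate `x`, so
that `O_G = R⟦x⟧`), given by its equation `f(x) = x ^ d + ∑_{i < d} a_i x ^ i`, which is congruent
to `x ^ d` modulo topologically nilpotent elements. -/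
@[nolint unusedArguments]
structure Divisor {R : Type*} [CommRing R] [TopologicalSpace R] (G : FormalGroup R) (d : ℕ) where
  /-- the lower coefficients of the equation -/
  lower : Fin d → R
  nilp : ∀ i, IsTopologicallyNilpotent (lower i)

/-- The ring `A⟦x⟧ / f` of the closed subscheme of the formal affine line over `A` cut out
by `f`. -/
def CoordRing (A : Type*) [CommRing A] (f : A[X]) : Type _ :=
  A⟦X⟧ ⧸ Ideal.span {(f : A⟦X⟧)}

namespace CoordRing

variable {A : Type*} [CommRing A] (f : A[X])

instance : CommRing (CoordRing A f) :=
  inferInstanceAs (CommRing (A⟦X⟧ ⧸ Ideal.span {(f : A⟦X⟧)}))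

instance {R : Type*} [CommRing R] [Algebra R A] : Algebra R (CoordRing A f) :=
  inferInstanceAs (Algebra R (A⟦X⟧ ⧸ Ideal.span {(f : A⟦X⟧)}))

instance {R : Type*} [CommRing R] [Algebra R A] : IsScalarTower R A (CoordRing A f) :=
  inferInstanceAs (IsScalarTower R A (A⟦X⟧ ⧸ Ideal.span {(f : A⟦X⟧)}))

/-- The projection `A⟦x⟧ → A⟦x⟧ / f`. -/
def mk : A⟦X⟧ →ₐ[A] CoordRing A f := Ideal.Quotient.mkₐ A (Ideal.span {(f : A⟦X⟧)})

end CoordRing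

namespace Divisor

variable {R : Type*} [CommRing R] [TopologicalSpace R] {G : FormalGroup R} {d : ℕ}

/-- The equation `f_D` of the divisor `D`. -/
def eqn (D : Divisor G d) : R[X] := monicPoly D.lower

theorem monic_eqn (D : Divisor G d) : D.eqn.Monic := monic_monicPoly _

/-- `O_D = O_G / f_D`. -/
abbrev ring (D : Divisor G d) : Type _ := CoordRing R D.eqn

/-- `E ≤ D`: `E` is a closed subscheme of `D`, that is, `f_D` lies in the ideal of `E` in `O_G`. -/
def IsSub {e : ℕ} (E : Divisor G e) (D : Divisor G d) : Prop :=
  (D.eqn : R⟦X⟧) ∈ Ideal.span {(E.eqn : R⟦X⟧)}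

/-- The pullback of a divisor along a continuous ring map. -/
def baseChange (D : Divisor G d) (A : Type*) [CommRing A] [TopologicalSpace A] [Algebra R A]
    (h : Continuous (algebraMap R A)) : Divisor (G.map (algebraMap R A)) d where
  lower i := algebraMap R A (D.lower i)
  nilp i := (D.nilp i).map h

theorem eqn_baseChange (D : Divisor G d) (A : Type*) [CommRing A] [TopologicalSpace A]
    [Algebra R A] (h : Continuous (algebraMap R A)) :
    (D.baseChange A h).eqn = D.eqn.map (algebraMap R A) :=
  (map_monicPoly _ _).symm

/-! ### The scheme of subdivisors of degree `k` -/

variable (D : Divisor G d) (k : ℕ)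

/-- The ideal generated by the coefficients of the remainder of `f_D` on division by the generic
monic polynomial `x ^ k + ∑_{i < k} c_i x ^ i`: the smallest ideal modulo which the latter
divides `f_D`. -/
def subIdeal : Ideal (MvPolynomial (Fin k) R) :=
  Ideal.span (Set.range fun n : ℕ =>
    (D.eqn.map (algebraMap R (MvPolynomial (Fin k) R)) %ₘ
      monicPoly fun i : Fin k => (MvPolynomial.X i : MvPolynomial (Fin k) R)).coeff n)

/-- The ring `O_{Sub_k(D)}` of the scheme of divisors `D'` of degree `k` with `D' ≤ D`; see
`subPoints` for the fact that it represents the right functor. The coefficients `c_i` of `D'` are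
automatically topologically nilpotent (`tautological`), so that polynomials in the `c_i` may be used
in place of power series. -/
def SubRing : Type _ := MvPolynomial (Fin k) R ⧸ D.subIdeal k

instance : CommRing (D.SubRing k) :=
  inferInstanceAs (CommRing (MvPolynomial (Fin k) R ⧸ D.subIdeal k))

instance : Algebra R (D.SubRing k) :=
  inferInstanceAs (Algebra R (MvPolynomial (Fin k) R ⧸ D.subIdeal k))

/-- The projection `R[c_0, …, c_{k-1}] → O_{Sub_k(D)}`. -/
def subMk : MvPolynomial (Fin k) R →ₐ[R] D.SubRing k := Ideal.Quotient.mkₐ R (D.subIdeal k)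

/-- The tautological coefficients `c_i`, for `i < k`. -/
def subCoeff (i : Fin k) : D.SubRing k := D.subMk k (MvPolynomial.X i)

/-- The equation `f_{D'}` of the tautological divisor `D'` over `Sub_k(D)`. -/
def tautEqn : (D.SubRing k)[X] := monicPoly (D.subCoeff k)

theorem map_generic :
    (monicPoly fun i : Fin k => (MvPolynomial.X i : MvPolynomial (Fin k) R)).map
      (D.subMk k : MvPolynomial (Fin k) R →+* D.SubRing k) = D.tautEqn k :=
  map_monicPoly _ _

theorem tautEqn_dvd : D.tautEqn k ∣ D.eqn.map (algebraMap R (D.SubRing k)) := by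
  have hm : (D.tautEqn k).Monic := monic_monicPoly _
  rw [← modByMonic_eq_zero_iff_dvd hm, ← map_generic, ← (D.subMk k).comp_algebraMap,
    ← Polynomial.map_map, ← map_modByMonic _ (monic_monicPoly _)]
  ext n
  rw [coeff_map, coeff_zero]
  exact Ideal.Quotient.eq_zero_iff_mem.2 (Ideal.subset_span ⟨n, rfl⟩)

variable {k} in
/-- The map out of `O_{Sub_k(D)}` that classifies a monic divisor of `f_D` of degree `k`. -/
def subLift {A : Type*} [CommRing A] [Algebra R A] (b : Fin k → A)
    (hb : monicPoly b ∣ D.eqn.map (algebraMap R A)) : D.SubRing k →ₐ[R] A :=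
  Ideal.Quotient.liftₐ (D.subIdeal k) (MvPolynomial.aeval b) (by
    intro a ha
    have hle : D.subIdeal k ≤ RingHom.ker (MvPolynomial.aeval (R := R) b) := by
      refine Ideal.span_le.2 ?_
      rintro _ ⟨n, rfl⟩
      have h1 : ((D.eqn.map (algebraMap R (MvPolynomial (Fin k) R)) %ₘ
          monicPoly fun i : Fin k => (MvPolynomial.X i : MvPolynomial (Fin k) R)).map
          (MvPolynomial.aeval (R := R) b : MvPolynomial (Fin k) R →+* A)) = 0 := by
        rw [map_modByMonic _ (monic_monicPoly _), map_monicPoly, Polynomial.map_map,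
          AlgHom.comp_algebraMap]
        simp only [RingHom.coe_coe, MvPolynomial.aeval_X]
        exact (modByMonic_eq_zero_iff_dvd (monic_monicPoly _)).2 hb
      have h2 := congrArg (fun q => coeff q n) h1
      simpa [coeff_map] using h2
    exact hle ha)

variable {k} in
theorem subLift_subCoeff {A : Type*} [CommRing A] [Algebra R A] (b : Fin k → A)
    (hb : monicPoly b ∣ D.eqn.map (algebraMap R A)) (i : Fin k) :
    D.subLift b hb (D.subCoeff k i) = b i := by
  change MvPolynomial.aeval b (MvPolynomial.X i) = b i
  simp

variable {k} in
theorem subHom_ext {A : Type*} [CommRing A] [Algebra R A] {φ ψ : D.SubRing k →ₐ[R] A}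
    (h : ∀ i, φ (D.subCoeff k i) = ψ (D.subCoeff k i)) : φ = ψ := by
  have h1 : φ.comp (D.subMk k) = ψ.comp (D.subMk k) := MvPolynomial.algHom_ext h
  refine AlgHom.ext fun t => ?_
  obtain ⟨p, rfl⟩ : ∃ p, D.subMk k p = t := Ideal.Quotient.mk_surjective t
  exact DFunLike.congr_fun h1 p

/-- The linear topology on `O_{Sub_k(D)}` defined by the ideals generated by the open ideals
of `R`. -/
@[reducible]
def subTopology : TopologicalSpace (D.SubRing k) :=
  ⨅ I : {I : Ideal R // IsOpen (I : Set R)},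
    TopologicalSpace.induced (Ideal.Quotient.mk (I.1.map (algebraMap R (D.SubRing k)))) ⊥

/-- The tautological divisor `D'` of degree `k` over `Sub_k(D)`. -/
def tautological : @Divisor (D.SubRing k) _ (D.subTopology k)
    (G.map (algebraMap R (D.SubRing k))) k :=
  letI := D.subTopology k
  { lower := D.subCoeff k
    nilp := by
      intro i
      rw [IsTopologicallyNilpotent, show 𝓝 (0 : D.SubRing k) = ⨅ I : {I : Ideal R //
        IsOpen (I : Set R)}, (pure 0 : Filter _).comap
          (Ideal.Quotient.mk (I.1.map (algebraMap R (D.SubRing k)))) by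
        refine nhds_iInf.trans ?_
        refine iInf_congr fun I => ?_
        let _ : TopologicalSpace (D.SubRing k ⧸ I.1.map (algebraMap R (D.SubRing k))) := ⊥
        have _ : DiscreteTopology (D.SubRing k ⧸ I.1.map (algebraMap R (D.SubRing k))) := ⟨rfl⟩
        rw [nhds_induced, map_zero, nhds_discrete]]
      refine Filter.tendsto_iInf.2 fun I => Filter.tendsto_comap_iff.2 ?_
      set J := I.1.map (algebraMap R (D.SubRing k)) with hJ
      have hnil : ∀ j, IsNilpotent (Ideal.Quotient.mk J
          (algebraMap R (D.SubRing k) (D.lower j))) := by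
        intro j
        have hmem : (I.1 : Set R) ∈ 𝓝 (0 : R) := I.2.mem_nhds I.1.zero_mem
        obtain ⟨n, hn⟩ := ((D.nilp j).eventually_mem hmem).exists
        refine ⟨n, ?_⟩
        rw [← map_pow, ← map_pow, Ideal.Quotient.eq_zero_iff_mem]
        exact Ideal.mem_map_of_mem _ hn
      have hdvd := Polynomial.map_dvd (Ideal.Quotient.mk J) (D.tautEqn_dvd k)
      rw [tautEqn, eqn, map_monicPoly, map_monicPoly,
        map_monicPoly (Ideal.Quotient.mk J) (fun i => algebraMap R (D.SubRing k) (D.lower i))]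
        at hdvd
      obtain ⟨n, hn⟩ := isNilpotent_coeff_of_dvd hnil hdvd i
      refine Filter.tendsto_pure.2 ?_
      filter_upwards [Filter.eventually_ge_atTop n] with m hm
      rw [Function.comp_apply, map_pow]
      exact pow_eq_zero_of_le hm hn }

theorem eqn_tautological :
    @Divisor.eqn _ _ (D.subTopology k) _ _ (D.tautological k) = D.tautEqn k := rfl

variable {k} in
/-- `Spf O_{Sub_k(D)}` represents the functor of subdivisors of degree `k` of `D`: for a discrete
ring `A` over `S`, the `A`-valued points are the divisors of degree `k` on `G` over `A` that are
contained in the pullback of `D`. -/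
def subPoints (A : Type*) [CommRing A] [TopologicalSpace A] [DiscreteTopology A] [Algebra R A]
    (h : Continuous (algebraMap R A)) :
    (D.SubRing k →ₐ[R] A) ≃
      {E : Divisor (G.map (algebraMap R A)) k // E.IsSub (D.baseChange A h)} where
  toFun φ := ⟨⟨fun i => φ (D.subCoeff k i), by
      have hdvd := Polynomial.map_dvd (φ : D.SubRing k →+* A) (D.tautEqn_dvd k)
      rw [Polynomial.map_map, AlgHom.comp_algebraMap, tautEqn, eqn, map_monicPoly,
        map_monicPoly] at hdvd
      intro i
      obtain ⟨n, hn⟩ := isNilpotent_coeff_of_dvd (fun j => by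
        have hj := (D.nilp j).map h
        have h0 : ({0} : Set A) ∈ 𝓝 (0 : A) := (isOpen_discrete _).mem_nhds rfl
        obtain ⟨n, hn⟩ := (hj.eventually_mem h0).exists
        exact ⟨n, hn⟩) hdvd i
      exact tendsto_atTop_of_eventually_const (i₀ := n) fun m hm => pow_eq_zero_of_le hm hn⟩, by
    have hdvd := Polynomial.map_dvd (φ : D.SubRing k →+* A) (D.tautEqn_dvd k)
    rw [Polynomial.map_map, AlgHom.comp_algebraMap, tautEqn, map_monicPoly] at hdvd
    rw [IsSub, Ideal.mem_span_singleton, eqn_baseChange]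
    obtain ⟨q, hq⟩ := hdvd
    exact ⟨(q : A⟦X⟧), (congrArg (fun p : A[X] => (p : A⟦X⟧)) hq).trans (Polynomial.coe_mul _ _)⟩⟩
  invFun E := D.subLift E.1.lower (by
    have hE := E.2
    rw [IsSub, Ideal.mem_span_singleton, eqn_baseChange] at hE
    refine dvd_of_coe_dvd (fun j => ?_) hE
    have h0 : ({0} : Set A) ∈ 𝓝 (0 : A) := (isOpen_discrete _).mem_nhds rfl
    obtain ⟨n, hn⟩ := ((E.1.nilp j).eventually_mem h0).exists
    exact ⟨n, hn⟩)
  left_inv φ := by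
    refine D.subHom_ext fun i => ?_
    simp only [subLift_subCoeff]
  right_inv E := by
    obtain ⟨⟨b, hb⟩, hE⟩ := E
    simp only [Subtype.mk.injEq, Divisor.mk.injEq]
    funext i
    exact D.subLift_subCoeff _ _ i

/-! ### The comparison map of exterior powers -/

/-- `O_{D'}`, the ring of the tautological divisor of degree `k` over `Sub_k(D)`. -/
abbrev TautRing : Type _ := CoordRing (D.SubRing k) (D.tautEqn k)

/-- The map `O_D → O_{D'}` that is induced by `R⟦x⟧ → O_{Sub_k(D)}⟦x⟧`. -/
def toTautRing : D.ring →ₐ[R] D.TautRing k :=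
  Ideal.quotientMapₐ _ (PowerSeries.mapAlgHom (Algebra.ofId R (D.SubRing k))) (by
    rw [Ideal.span_singleton_le_iff_mem, Ideal.mem_comap, Ideal.mem_span_singleton]
    obtain ⟨q, hq⟩ := D.tautEqn_dvd k
    refine ⟨(q : (D.SubRing k)⟦X⟧), ?_⟩
    rw [← Polynomial.coe_mul, ← hq, Polynomial.polynomial_map_coe]
    rfl)

/-- The map `φ : ⋀^k_S O_D → ⋀^k_{Sub_k(D)} O_{D'}`,
`a_0 ∧ ⋯ ∧ a_{k-1} ↦ a_0 ∧ ⋯ ∧ a_{k-1}`. -/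
def phi : (⋀[R]^k D.ring) →ₗ[R] (⋀[D.SubRing k]^k (D.TautRing k)) :=
  exteriorPower.alternatingMapLinearEquiv
    { ((exteriorPower.ιMulti (D.SubRing k) k (M := D.TautRing k)).toMultilinearMap.restrictScalars
        R).compLinearMap (fun _ => (D.toTautRing k).toLinearMap) with
      map_eq_zero_of_eq' := fun v _ _ hv hij =>
        (exteriorPower.ιMulti (D.SubRing k) k (M := D.TautRing k)).map_eq_zero_of_eq
          (fun l => D.toTautRing k (v l)) (congrArg (D.toTautRing k) hv) hij }

theorem phi_ιMulti (v : Fin k → D.ring) :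
    D.phi k (exteriorPower.ιMulti R k v) =
      exteriorPower.ιMulti (D.SubRing k) k fun i => D.toTautRing k (v i) :=
  exteriorPower.alternatingMapLinearEquiv_apply_ιMulti _ _

/-! ### The action of `O_{Sub_k(D)}` on `⋀^k O_D` -/

/-- `O_{D^k} = O_D ⊗ ⋯ ⊗ O_D`. -/
abbrev PowRing : Type _ := ⨂[R] _ : Fin k, D.ring

/-- `s` is invariant under the symmetric group, which acts on `O_{D^k}` by permuting the tensor
factors; that is, `s` lies in `O_{D^k/Σ_k}`. -/
def IsSymm (s : D.PowRing k) : Prop :=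
  ∀ σ : Equiv.Perm (Fin k), PiTensorProduct.reindex R (fun _ : Fin k => D.ring) σ s = s

/-- The projection `μ_k : O_D ⊗ ⋯ ⊗ O_D → ⋀^k O_D`. -/
def mu : D.PowRing k →ₗ[R] ⋀[R]^k D.ring :=
  PiTensorProduct.lift (exteriorPower.ιMulti R k (M := D.ring)).toMultilinearMap

/-- The coordinate `x_j` of the `j`-th factor of `D^k`. -/
def xCoord (j : Fin k) : D.PowRing k :=
  PiTensorProduct.singleAlgHom (R := R) (A := fun _ : Fin k => D.ring) j
    (CoordRing.mk _ PowerSeries.X)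

/-- The equation `∏_{j < k} (t - x_j)` of the divisor `[x_0] + ⋯ + [x_{k-1}]` over `D^k`. -/
def pointsEqn : (D.PowRing k)[X] := ∏ j : Fin k, (X - C (D.xCoord k j))

theorem monic_pointsEqn : (D.pointsEqn k).Monic :=
  monic_prod_of_monic _ _ fun _ _ => monic_X_sub_C _

/-- The ideal `J_k` of the closed subscheme `P_k D` of `D^k`, where
`[x_0] + ⋯ + [x_{k-1}] ≤ D`: the smallest ideal modulo which `∏_j (t - x_j)` divides `f_D`. -/
def pointsIdeal : Ideal (D.PowRing k) :=
  Ideal.span (Set.range fun n : ℕ =>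
    (D.eqn.map (algebraMap R (D.PowRing k)) %ₘ D.pointsEqn k).coeff n)

/-- `O_{P_k D} = O_{D^k} / J_k`. -/
abbrev PointsRing : Type _ := D.PowRing k ⧸ D.pointsIdeal k

theorem monicPoly_pointsEqn :
    (monicPoly fun i : Fin k => Ideal.Quotient.mk (D.pointsIdeal k) ((D.pointsEqn k).coeff i)) =
      (D.pointsEqn k).map (Ideal.Quotient.mk (D.pointsIdeal k)) := by
  rcases subsingleton_or_nontrivial (D.PowRing k) with h | h
  · have _ : Subsingleton (D.PointsRing k) := Ideal.Quotient.mk_surjective.subsingleton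
    exact Subsingleton.elim _ _
  · rw [← map_monicPoly, monicPoly_coeff_eq (D.monic_pointsEqn k)]
    rw [pointsEqn, natDegree_prod_of_monic _ _ fun _ _ => monic_X_sub_C _]
    simp

theorem pointsEqn_dvd :
    (D.pointsEqn k).map (Ideal.Quotient.mk (D.pointsIdeal k)) ∣
      D.eqn.map (algebraMap R (D.PointsRing k)) := by
  rw [← modByMonic_eq_zero_iff_dvd ((D.monic_pointsEqn k).map _),
    show algebraMap R (D.PointsRing k) = (Ideal.Quotient.mk (D.pointsIdeal k)).comp
      (algebraMap R (D.PowRing k)) from rfl,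
    ← Polynomial.map_map, ← map_modByMonic _ (D.monic_pointsEqn k)]
  ext n
  rw [coeff_map, coeff_zero, Ideal.Quotient.eq_zero_iff_mem]
  exact Ideal.subset_span ⟨n, rfl⟩

/-- The ring map `O_{Sub_k(D)} → O_{P_k D}` of the projection `P_k D → Sub_k(D)` that sends
`(a_0, …, a_{k-1})` to `[a_0] + ⋯ + [a_{k-1}]`. -/
def toPoints : D.SubRing k →ₐ[R] D.PointsRing k :=
  D.subLift (fun i => Ideal.Quotient.mk (D.pointsIdeal k) ((D.pointsEqn k).coeff i))
    (by rw [monicPoly_pointsEqn]; exact D.pointsEqn_dvd k)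

/-- The `O_{Sub_k(D)}`-module structure on `⋀^k O_D` that is induced by the action of the symmetric
elements of `O_{D^k}`: if the symmetric element `s` and the element `t` of `O_{Sub_k(D)}` have the
same image in `O_{P_k D}`, then `t • μ_k(b) = μ_k(s b)`. -/
def IsNaturalModule (inst : Module (D.SubRing k) (⋀[R]^k D.ring)) : Prop :=
  ∀ (s : D.PowRing k) (t : D.SubRing k), D.IsSymm k s →
    D.toPoints k t = Ideal.Quotient.mk (D.pointsIdeal k) s →
    ∀ b : D.PowRing k, inst.toSMul.smul t (D.mu k b) = D.mu k (s * b)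

end Divisor

end SubDiv

end

/-!
For `k` points `y_j` with `g(t) = ∏ (t - y_j)`, write the remainder of a polynomial `a` modulo `g`
as `∑ ρ(a)_j t ^ j`. Since `a(y_l) = ∑ ρ(a)_j y_l ^ j`, there is the determinant identity
`det (a_m(y_l)) = Δ(y) * det (ρ(a_m)_j)` with the Vandermonde determinant `Δ(y)`
(`det_eval_eq_det_vandermonde_mul`). It holds over every commutative ring, and `ρ` depends only on
the coefficients of `g`.

Let `ψ : ⋀^k O_D → O_{Sub_k(D)}` send `a_0 ∧ ⋯ ∧ a_{k-1}` to the determinant of the remainders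
modulo the tautological equation (`Divisor.tautDet`). Over `O_{D^k}`, the left-hand side of the
identity is the antisymmetrization of `a_0 ⊗ ⋯ ⊗ a_{k-1}`. Moreover `Δ` annihilates `J_k`, because
the remainder of `f_D` modulo `∏ (t - x_j)` vanishes at all the `x_j`. Hence the antisymmetrization
of `z` is `Δ * q(ψ(z))` (`Divisor.toTensorPower_eq_mulVandermonde`). Antisymmetrization is injective
on exterior powers of free modules, so `ψ` is injective.

The image of `ψ` contains `ψ(1 ∧ x ∧ ⋯ ∧ x ^ (k - 1)) = 1`, and it is closed under multiplication by
the coefficients `c_i`: expand `det ρ * det (t - M) = det (t ρ - ρ M)` multilinearly, where `M` is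
the companion matrix of `f_{D'}`, with characteristic polynomial `f_{D'}`
(`coeff_mul_det_remCoeff_mem`). So `ψ` is bijective.

The module structure is transported along `ψ`. For a symmetric `s` with `q(t) = s` modulo `J_k`, the
elements `t • μ_k(b)` and `μ_k(s b)` have the same antisymmetrization `s * Δ * q(ψ(μ_k(b)))`, so
the structure is the natural one (`Divisor.isNaturalModule_exteriorModule`). It is unique because
the coefficients of `∏ (t - x_j)` are symmetric, so that every `t` has such an `s`.

All of this uses polynomial representatives, that is, Weierstrass division by `f_D` in `R⟦x⟧`
(`weierstrassDivision_monicPoly`). The bijection `ψ` shows that `O_{Sub_k(D)}` is free of finite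
rank over `R`, and then Weierstrass division passes from `f_D` to its divisor `f_{D'}` over
`O_{Sub_k(D)}` (`WeierstrassDivision.of_dvd_map`). So `O_{D'}` is free with basis
`1, x, …, x ^ (k - 1)`, its top exterior power is free of rank one, and `phi` becomes `ψ`
(`Divisor.tautExteriorEquiv_phi`).
-/

noncomputable section

namespace SubDiv

open Polynomial

/-! ### Remainders modulo a monic polynomial -/

section Remainder

variable {A B : Type*} [CommRing A] [CommRing B] {k : ℕ}

/-- The coefficients of the remainder of a polynomial on division by `monicPoly b`. Indexing them by
`Fin k` also makes sense over the zero ring, where `monicPoly b` has degree `⊥`. -/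
def remCoeff (b : Fin k → A) : A[X] →ₗ[A] (Fin k → A) :=
  LinearMap.pi fun j => lcoeff A j ∘ₗ modByMonicHom (monicPoly b)

theorem remCoeff_apply (b : Fin k → A) (a : A[X]) (j : Fin k) :
    remCoeff b a j = (a %ₘ monicPoly b).coeff j := rfl

theorem sum_remCoeff (b : Fin k → A) (a : A[X]) :
    ∑ j : Fin k, C (remCoeff b a j) * X ^ (j : ℕ) = a %ₘ monicPoly b := by
  nontriviality A
  have hlt : (a %ₘ monicPoly b).natDegree < k ∨ a %ₘ monicPoly b = 0 := by
    by_cases h0 : a %ₘ monicPoly b = 0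
    · exact Or.inr h0
    · refine Or.inl ((natDegree_lt_iff_degree_lt h0).2 ?_)
      have := degree_modByMonic_lt a (monic_monicPoly b)
      rwa [degree_eq_natDegree (monic_monicPoly b).ne_zero, natDegree_monicPoly] at this
  rcases hlt with hlt | h0
  · conv_rhs => rw [as_sum_range_C_mul_X_pow' _ hlt]
    exact (Finset.sum_range fun j => C ((a %ₘ monicPoly b).coeff j) * X ^ j).symm
  · simp [remCoeff_apply, h0]

theorem remCoeff_eq_zero_iff (b : Fin k → A) (a : A[X]) :
    remCoeff b a = 0 ↔ monicPoly b ∣ a := by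
  rw [← modByMonic_eq_zero_iff_dvd (monic_monicPoly b)]
  constructor
  · intro h
    rw [← sum_remCoeff, h]
    simp
  · intro h
    ext j
    simp [remCoeff_apply, h]

theorem remCoeff_eq_of_dvd_sub {b : Fin k → A} {a a' : A[X]} (h : monicPoly b ∣ a - a') :
    remCoeff b a = remCoeff b a' := by
  rw [← sub_eq_zero, ← map_sub, remCoeff_eq_zero_iff]
  exact h

theorem dvd_sub_modByMonic (b : Fin k → A) (a : A[X]) :
    monicPoly b ∣ a - a %ₘ monicPoly b :=
  ⟨a /ₘ monicPoly b, by linear_combination -modByMonic_add_div a (monicPoly b)⟩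

theorem remCoeff_map (g : A →+* B) (b : Fin k → A) (a : A[X]) (j : Fin k) :
    remCoeff (fun i => g (b i)) (a.map g) j = g (remCoeff b a j) := by
  rw [remCoeff_apply, remCoeff_apply, ← map_monicPoly, ← map_modByMonic _ (monic_monicPoly b),
    coeff_map]

theorem remCoeff_sum (b : Fin k → A) (c : Fin k → A) :
    remCoeff b (∑ j : Fin k, C (c j) * X ^ (j : ℕ)) = c := by
  nontriviality A
  ext j
  rw [remCoeff_apply, (modByMonic_eq_self_iff (monic_monicPoly b)).2]
  · have := coeff_monicPoly c j
    rwa [monicPoly, coeff_add, coeff_X_pow, if_neg j.2.ne, zero_add] at this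
  · rw [degree_eq_natDegree (monic_monicPoly b).ne_zero, natDegree_monicPoly]
    exact degree_lower_lt c

theorem remCoeff_X_pow (b : Fin k → A) (i : Fin k) :
    remCoeff b (X ^ (i : ℕ)) = Pi.single i 1 := by
  rw [← remCoeff_sum b (Pi.single i 1), Finset.sum_eq_single i]
  · simp
  · intro j _ hj
    simp [Pi.single_eq_of_ne hj]
  · simp

theorem remCoeff_surjective (b : Fin k → A) : Function.Surjective (remCoeff b) :=
  fun c => ⟨_, remCoeff_sum b c⟩

/-- The companion matrix of `monicPoly b`: multiplication by `X`, acting on row vectors of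
remainders. -/
def companion (b : Fin k → A) : Matrix (Fin k) (Fin k) A :=
  Matrix.of fun i => remCoeff b (X ^ ((i : ℕ) + 1))

open Matrix in
theorem remCoeff_X_mul (b : Fin k → A) (a : A[X]) :
    remCoeff b (X * a) = remCoeff b a ᵥ* companion b := by
  have h : monicPoly b ∣ X * a - X * (a %ₘ monicPoly b) := by
    rw [← mul_sub]
    exact (dvd_sub_modByMonic b a).mul_left X
  rw [remCoeff_eq_of_dvd_sub h, ← sum_remCoeff, Finset.mul_sum, map_sum]
  ext j
  rw [vecMul, dotProduct, Finset.sum_apply]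
  refine Finset.sum_congr rfl fun i _ => ?_
  rw [show X * (C (remCoeff b a i) * X ^ (i : ℕ)) = remCoeff b a i • X ^ ((i : ℕ) + 1) by
    rw [smul_eq_C_mul]; ring, map_smul]
  rfl

open Matrix in
theorem remCoeff_mul (b : Fin k → A) (q a : A[X]) :
    remCoeff b (q * a) = remCoeff b a ᵥ* aeval (companion b) q := by
  induction q using Polynomial.induction_on generalizing a with
  | C r =>
    rw [← smul_eq_C_mul, map_smul, aeval_C, Algebra.algebraMap_eq_smul_one, vecMul_smul, vecMul_one]
  | add p q hp hq => rw [add_mul, map_add, hp, hq, map_add, vecMul_add]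
  | monomial n r ih =>
    rw [pow_succ, ← mul_assoc, mul_assoc _ X a, ih, remCoeff_X_mul, vecMul_vecMul, mul_comm _ X,
      map_mul _ X, aeval_X]

theorem charpoly_companion (b : Fin k → A) : (companion b).charpoly = monicPoly b := by
  nontriviality A
  refine eq_of_monic_of_dvd_of_natDegree_le (monic_monicPoly b) (Matrix.charpoly_monic _) ?_ ?_
  · rw [← remCoeff_eq_zero_iff, ← mul_one (companion b).charpoly, remCoeff_mul,
      Matrix.aeval_self_charpoly, Matrix.vecMul_zero]
  · rw [natDegree_monicPoly, Matrix.charpoly_natDegree_eq_dim, Fintype.card_fin]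

/-- Multiplying a determinant of remainders by a coefficient of `monicPoly b` gives a signed sum of
determinants of remainders in which some of the polynomials have been multiplied by `X`. This is the
multilinear expansion of `det ρ * det (t - companion b) = det (t ρ - ρ * companion b)`, where the
rows of `ρ` are the given remainders. -/
theorem coeff_mul_det_remCoeff_mem (b : Fin k → A) (a : Fin k → A[X]) (N : AddSubgroup A)
    (hN : ∀ s : Finset (Fin k),
      (Matrix.of fun l => remCoeff b (s.piecewise a (fun l => X * a l) l)).det ∈ N) (i : ℕ) :
    (monicPoly b).coeff i * (Matrix.of fun l => remCoeff b (a l)).det ∈ N := by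
  set ρ : Matrix (Fin k) (Fin k) A := Matrix.of fun l => remCoeff b (a l) with hρ
  have hrow : ρ.map C * (companion b).charmatrix =
      (fun l : Fin k => (X : A[X]) • fun j => C (remCoeff b (a l) j)) +
        fun l : Fin k => (-1 : A[X]) • fun j => C (remCoeff b (X * a l) j) := by
    have h1 : ρ.map C * (companion b).charmatrix =
        (X : A[X]) • ρ.map C - (ρ * companion b).map C := by
      rw [Matrix.charmatrix, mul_sub, Matrix.map_mul, Matrix.scalar_apply,
        ← Matrix.smul_eq_mul_diagonal]
      rfl
    rw [h1]
    ext1 l j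
    simp only [Pi.add_apply, Pi.smul_apply, Matrix.sub_apply, Matrix.smul_apply, Matrix.map_apply,
      smul_eq_mul, neg_mul, one_mul, remCoeff_X_mul, sub_eq_add_neg]
    rfl
  have hdet : C ρ.det * monicPoly b = ∑ s : Finset (Fin k), (∏ l, s.piecewise (fun _ => X)
      (fun _ => (-1 : A[X])) l) *
        C (Matrix.of fun l => remCoeff b (s.piecewise a (fun l => X * a l) l)).det := by
    rw [← charpoly_companion, Matrix.charpoly, RingHom.map_det, ← Matrix.det_mul,
      RingHom.mapMatrix_apply, hrow]
    change Matrix.detRowAlternating _ = _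
    rw [AlternatingMap.map_add_univ]
    refine Finset.sum_congr rfl fun s _ => ?_
    rw [RingHom.map_det, ← Matrix.det_mul_column]
    refine congrArg Matrix.det ?_
    ext1 l j
    by_cases hl : l ∈ s <;> simp [hl]
  have hci := congrArg (fun p => coeff p i) hdet
  simp only [coeff_C_mul, finsetSum_coeff] at hci
  rw [mul_comm, hci]
  refine N.sum_mem fun s _ => ?_
  rw [coeff_mul_C, Finset.prod_piecewise, Finset.prod_const, Finset.prod_const]
  rcases neg_one_pow_eq_or A[X] (Finset.univ \ s).card with h | h <;>
    rw [h] <;> simp only [mul_one, mul_neg, coeff_neg, neg_mul, coeff_X_pow, ite_mul, one_mul,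
      zero_mul] <;> split_ifs <;> simp [hN s]

end Remainder

/-! ### Weierstrass division -/

/-- Weierstrass division by `f`: polynomials represent all classes of power series modulo `f`, and
`f` divides the same polynomials in the ring of power series as in the ring of polynomials. -/
def WeierstrassDivision {A : Type*} [CommRing A] (f : A[X]) : Prop :=
  (∀ g : A⟦X⟧, ∃ p : A[X], (f : A⟦X⟧) ∣ g - p) ∧ ∀ p : A[X], (f : A⟦X⟧) ∣ p → f ∣ p

section Topology

variable {R : Type*} [CommRing R]

theorem monicPoly_dvd_X_pow_of_isNilpotent {d : ℕ} {a : Fin d → R} (ha : ∀ i, IsNilpotent (a i)) :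
    ∃ N : ℕ, monicPoly a ∣ X ^ N := by
  have hnil : IsNilpotent (∑ i : Fin d, C (a i) * X ^ (i : ℕ) : R[X]) :=
    isNilpotent_sum fun i _ => (Commute.all _ _).isNilpotent_mul_right ((ha i).map C)
  obtain ⟨M, hM⟩ := hnil
  refine ⟨d * M, ?_⟩
  have h1 : monicPoly a ∣ (X ^ d) ^ M - (-∑ i : Fin d, C (a i) * X ^ (i : ℕ) : R[X]) ^ M := by
    refine dvd_trans (dvd_of_eq ?_) (sub_dvd_pow_sub_pow _ _ M)
    rw [monicPoly, sub_neg_eq_add]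
  rwa [neg_pow, hM, mul_zero, sub_zero, ← pow_mul] at h1

variable [TopologicalSpace R]

theorem isNilpotent_mk_of_isTopologicallyNilpotent {a : R} (ha : IsTopologicallyNilpotent a)
    {I : Ideal R} (hI : IsOpen (I : Set R)) : IsNilpotent (Ideal.Quotient.mk I a) := by
  obtain ⟨n, hn⟩ := (ha.eventually_mem (hI.mem_nhds I.zero_mem)).exists
  exact ⟨n, by rw [← map_pow, Ideal.Quotient.eq_zero_iff_mem]; exact hn⟩

variable {d : ℕ} {a : Fin d → R}

/-- Modulo an open ideal, `monicPoly a` divides a power of `X`, so that both the remainders and the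
quotients of the powers of `X` on division by `monicPoly a` tend to zero coefficientwise. -/
theorem exists_coeff_divMod_X_pow_mem (ha : ∀ i, IsTopologicallyNilpotent (a i)) {I : Ideal R}
    (hI : IsOpen (I : Set R)) (m : ℕ) :
    ∃ N : ℕ, ∀ n ≥ N, (X ^ n %ₘ monicPoly a).coeff m ∈ I ∧ (X ^ n /ₘ monicPoly a).coeff m ∈ I := by
  set π := Ideal.Quotient.mk I
  obtain ⟨N, u, hu⟩ := monicPoly_dvd_X_pow_of_isNilpotent fun i =>
    isNilpotent_mk_of_isTopologicallyNilpotent (ha i) hI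
  refine ⟨N + m + 1, fun n hn => ?_⟩
  have hm := monic_monicPoly a
  have hmπ : (monicPoly fun i => π (a i)).Monic := monic_monicPoly _
  have hX : (X : (R ⧸ I)[X]) ^ n = monicPoly (fun i => π (a i)) * (X ^ (n - N) * u) := by
    rw [mul_left_comm, ← hu, ← pow_add]
    congr 1
    omega
  have key : ∀ p : R[X], p.coeff m ∈ I ↔ (p.map π).coeff m = 0 := fun p => by
    rw [coeff_map, Ideal.Quotient.eq_zero_iff_mem]
  rw [key, key, map_modByMonic _ hm, map_divByMonic _ hm, Polynomial.map_pow, map_X, map_monicPoly,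
    hX]
  constructor
  · rw [(modByMonic_eq_zero_iff_dvd hmπ).2 (dvd_mul_right _ _), coeff_zero]
  · rw [mul_divByMonic_cancel_left _ hmπ, coeff_X_pow_mul', if_neg (by omega)]

end Topology

theorem eq_zero_of_forall_mem_open_ideal {R : Type*} [CommRing R]
    [TopologicalSpace R] [IsTopologicalRing R] [IsLinearTopology R R] [T2Space R] {r : R}
    (h : ∀ I : Ideal R, IsOpen (I : Set R) → r ∈ I) : r = 0 := by
  by_contra hr
  obtain ⟨I, hI, hrI⟩ := (IsLinearTopology.hasBasis_open_ideal (R := R)).mem_iff.1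
    (isOpen_compl_singleton.mem_nhds (show (0 : R) ∈ ({r}ᶜ : Set R) from fun h => hr h.symm))
  exact hrI (h I hI) rfl

theorem nonarchimedeanRing_of_isLinearTopology {R : Type*} [CommRing R]
    [TopologicalSpace R] [IsTopologicalRing R] [IsLinearTopology R R] :
    NonarchimedeanRing R where
  is_nonarchimedean U hU := by
    obtain ⟨I, hI, hIU⟩ := (IsLinearTopology.hasBasis_open_ideal (R := R)).mem_iff.1 hU
    exact ⟨⟨I.toAddSubgroup, hI⟩, hIU⟩

theorem summable_mul_of_eventually_mem_open_ideal {R : Type*} [CommRing R]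
    [UniformSpace R] [IsUniformAddGroup R] [IsTopologicalRing R] [IsLinearTopology R R]
    [CompleteSpace R] (c u : ℕ → R)
    (hu : ∀ I : Ideal R, IsOpen (I : Set R) → ∃ N, ∀ n ≥ N, u n ∈ I) :
    Summable fun n => c n * u n := by
  have := nonarchimedeanRing_of_isLinearTopology (R := R)
  refine NonarchimedeanAddGroup.summable_of_tendsto_cofinite_zero ?_
  rw [Nat.cofinite_eq_atTop, (IsLinearTopology.hasBasis_open_ideal (R := R)).tendsto_right_iff]
  intro I hI
  obtain ⟨N, hN⟩ := hu I hI
  filter_upwards [Filter.eventually_ge_atTop N] with n hn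
  exact I.mul_mem_left _ (hN n hn)

theorem dvd_of_coe_dvd_of_isTopologicallyNilpotent {R : Type*} [CommRing R]
    [TopologicalSpace R] [IsTopologicalRing R] [IsLinearTopology R R] [T2Space R]
    {d : ℕ} {a : Fin d → R} (ha : ∀ i, IsTopologicallyNilpotent (a i)) {p : R[X]}
    (h : (monicPoly a : R⟦X⟧) ∣ p) : monicPoly a ∣ p := by
  rw [← remCoeff_eq_zero_iff]
  ext j
  refine eq_zero_of_forall_mem_open_ideal fun I hI => ?_
  have h1 := map_dvd (PowerSeries.map (Ideal.Quotient.mk I)) h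
  rw [← polynomial_map_coe, ← polynomial_map_coe, map_monicPoly] at h1
  have h2 := dvd_of_coe_dvd
    (fun i => isNilpotent_mk_of_isTopologicallyNilpotent (ha i) hI) h1
  rw [← remCoeff_eq_zero_iff] at h2
  rw [← Ideal.Quotient.eq_zero_iff_mem, ← remCoeff_map, h2]
  rfl

open PowerSeries.WithPiTopology in
/-- Weierstrass division over a complete linearly topologized ring: for `g = ∑ g_n x ^ n`, the
remainder is `∑ g_n r_n` and the quotient is `∑ g_n q_n`, where `x ^ n = f q_n + r_n`. -/
theorem weierstrassDivision_monicPoly {R : Type*} [CommRing R]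
    [UniformSpace R] [IsUniformAddGroup R] [IsTopologicalRing R] [IsLinearTopology R R] [T2Space R]
    [CompleteSpace R] {d : ℕ} {a : Fin d → R} (ha : ∀ i, IsTopologicallyNilpotent (a i)) :
    WeierstrassDivision (monicPoly a) := by
  refine ⟨fun g => ?_, fun p => dvd_of_coe_dvd_of_isTopologicallyNilpotent ha⟩
  set f := monicPoly a with hf
  have hr : ∀ m, Summable fun n => PowerSeries.coeff n g * (X ^ n %ₘ f).coeff m := fun m =>
    summable_mul_of_eventually_mem_open_ideal _ _ fun I hI =>
      (exists_coeff_divMod_X_pow_mem ha hI m).imp fun _ h n hn => (h n hn).1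
  have hq : ∀ m, Summable fun n => PowerSeries.coeff n g * (X ^ n /ₘ f).coeff m := fun m =>
    summable_mul_of_eventually_mem_open_ideal _ _ fun I hI =>
      (exists_coeff_divMod_X_pow_mem ha hI m).imp fun _ h n hn => (h n hn).2
  set q : R⟦X⟧ := PowerSeries.mk fun m => ∑' n, PowerSeries.coeff n g * (X ^ n /ₘ f).coeff m
    with hq_def
  set r : R[X] := ∑ j : Fin d, C (∑' n, PowerSeries.coeff n g * (X ^ n %ₘ f).coeff j) * X ^ (j : ℕ)
    with hr_def
  have hqs : HasSum
      (fun n => PowerSeries.C (PowerSeries.coeff n g) * ((X ^ n /ₘ f : R[X]) : R⟦X⟧)) q := by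
    rw [hasSum_iff_hasSum_coeff]
    intro m
    simp only [PowerSeries.coeff_C_mul, Polynomial.coeff_coe, hq_def, PowerSeries.coeff_mk]
    exact (hq m).hasSum
  have hrs : HasSum
      (fun n => PowerSeries.C (PowerSeries.coeff n g) * ((X ^ n %ₘ f : R[X]) : R⟦X⟧)) r := by
    have h1 : ∀ n, (X ^ n %ₘ f : R[X]) = ∑ j : Fin d, C ((X ^ n %ₘ f).coeff j) * X ^ (j : ℕ) :=
      fun n => (sum_remCoeff a (X ^ n)).symm
    rw [hasSum_iff_hasSum_coeff]
    intro m
    simp only [PowerSeries.coeff_C_mul, Polynomial.coeff_coe, hr_def, finsetSum_coeff, coeff_C_mul]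
    have h2 : ∀ n, (X ^ n %ₘ f : R[X]).coeff m =
        ∑ j : Fin d, (X ^ n %ₘ f).coeff j * (X ^ (j : ℕ) : R[X]).coeff m := fun n => by
      conv_lhs => rw [h1 n]
      simp only [finsetSum_coeff, coeff_C_mul]
    simp only [h2, Finset.mul_sum, ← mul_assoc]
    exact hasSum_sum fun j _ => (hr j).hasSum.mul_right _
  have hgs : HasSum
      (fun n => PowerSeries.C (PowerSeries.coeff n g) * ((X ^ n : R[X]) : R⟦X⟧)) g := by
    rw [hasSum_iff_hasSum_coeff]
    intro m
    convert hasSum_ite_eq m (PowerSeries.coeff m g) using 2 with n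
    rw [PowerSeries.coeff_C_mul, Polynomial.coeff_coe, coeff_X_pow]
    split_ifs with h1 h2 h2 <;> simp_all
  have := instIsTopologicalRing (R := R)
  have hsum := hrs.add (hqs.mul_left (f : R⟦X⟧))
  have heq : ∀ n, PowerSeries.C (PowerSeries.coeff n g) * ((X ^ n %ₘ f : R[X]) : R⟦X⟧) +
      (f : R⟦X⟧) * (PowerSeries.C (PowerSeries.coeff n g) * ((X ^ n /ₘ f : R[X]) : R⟦X⟧)) =
      PowerSeries.C (PowerSeries.coeff n g) * ((X ^ n : R[X]) : R⟦X⟧) := fun n => by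
    conv_rhs => rw [← modByMonic_add_div (X ^ n) f]
    rw [Polynomial.coe_add, Polynomial.coe_mul]
    ring
  simp only [heq] at hsum
  have := instT2Space (R := R)
  refine ⟨r, q, ?_⟩
  rw [hgs.unique hsum, add_sub_cancel_left]

/-! ### Coordinate rings of divisors -/

namespace CoordRing

variable {A : Type*} [CommRing A]

theorem aeval_mk_X (f p : A[X]) : aeval (mk f PowerSeries.X) p = mk f p := by
  induction p using Polynomial.induction_on' with
  | add p q hp hq => rw [map_add, hp, hq, Polynomial.coe_add, map_add]
  | monomial n r =>
    rw [aeval_monomial, ← C_mul_X_pow_eq_monomial, Polynomial.coe_mul, Polynomial.coe_C,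
      Polynomial.coe_pow, Polynomial.coe_X, map_mul, map_pow]
    rfl

theorem mk_eq_zero_iff (f : A[X]) (g : A⟦X⟧) : mk f g = 0 ↔ (f : A⟦X⟧) ∣ g :=
  Ideal.Quotient.eq_zero_iff_mem.trans Ideal.mem_span_singleton

theorem mk_surjective (f : A[X]) : Function.Surjective (mk f) := Ideal.Quotient.mk_surjective

variable {f : A[X]}

theorem aeval_surjective (hW : WeierstrassDivision f) :
    Function.Surjective (aeval (R := A) (mk f PowerSeries.X)) := fun y => by
  obtain ⟨g, rfl⟩ := mk_surjective f y
  obtain ⟨p, hp⟩ := hW.1 g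
  refine ⟨p, ?_⟩
  rw [← mk_eq_zero_iff, map_sub, sub_eq_zero] at hp
  rw [aeval_mk_X, hp]

theorem aeval_eq_zero_iff (hW : WeierstrassDivision f) (p : A[X]) :
    aeval (mk f PowerSeries.X) p = 0 ↔ f ∣ p := by
  rw [aeval_mk_X, mk_eq_zero_iff]
  refine ⟨hW.2 p, ?_⟩
  rintro ⟨q, rfl⟩
  exact ⟨q, Polynomial.coe_mul _ _⟩

/-- Coefficients of the remainder identify `A⟦x⟧ / f` with `A ^ k` when Weierstrass division by the
monic polynomial `f` of degree `k` is possible. -/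
def remEquiv {k : ℕ} (b : Fin k → A) (hW : WeierstrassDivision (monicPoly b)) :
    CoordRing A (monicPoly b) ≃ₗ[A] (Fin k → A) :=
  (LinearMap.quotKerEquivOfSurjective
      (aeval (R := A) (mk (monicPoly b) PowerSeries.X)).toLinearMap (aeval_surjective hW)).symm ≪≫ₗ
    Submodule.quotEquivOfEq _ _ (by
      ext p
      exact (aeval_eq_zero_iff hW p).trans (remCoeff_eq_zero_iff b p).symm) ≪≫ₗ
    (remCoeff b).quotKerEquivOfSurjective (remCoeff_surjective b)

theorem remEquiv_aeval {k : ℕ} (b : Fin k → A) (hW : WeierstrassDivision (monicPoly b)) (p : A[X]) :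
    remEquiv b hW (aeval (mk (monicPoly b) PowerSeries.X) p) = remCoeff b p := by
  have h : (LinearMap.quotKerEquivOfSurjective
      (aeval (R := A) (mk (monicPoly b) PowerSeries.X)).toLinearMap (aeval_surjective hW)).symm
        (aeval (mk (monicPoly b) PowerSeries.X) p) =
        Submodule.Quotient.mk p := by
    rw [LinearEquiv.symm_apply_eq]
    rfl
  simp only [remEquiv, LinearEquiv.trans_apply, h]
  rfl

end CoordRing

/-- Weierstrass division by `f` over `R` gives Weierstrass division, over a finite free
`R`-algebra `S`, by every divisor `p` of `f`. Representatives come from coordinatewise division by `f`.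
If `p` divides a polynomial `a` among power series and `f = p * p'`, then `f` divides `a * p'` among
polynomials, again coordinatewise, and `p'` cancels because `f` is monic. -/
theorem WeierstrassDivision.of_dvd_map {R S ι : Type*} [CommRing R] [CommRing S] [Algebra R S]
    [Finite ι] (e : Module.Basis ι R S) {f : R[X]} (hf : f.Monic) (hW : WeierstrassDivision f)
    {p : S[X]} (hp : p ∣ f.map (algebraMap R S)) : WeierstrassDivision p := by
  have := Fintype.ofFinite ι
  obtain ⟨p', hp'⟩ := hp
  set F : S⟦X⟧ := PowerSeries.map (algebraMap R S) f with hF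
  have hFc : ((f.map (algebraMap R S) : S[X]) : S⟦X⟧) = F := polynomial_map_coe
  have hpF : F = p * p' := by rw [← hFc, hp', Polynomial.coe_mul]
  -- Applying an `R`-linear form to all coefficients is linear over `R⟦X⟧`.
  have hcoord : ∀ (l : S →ₗ[R] R) (q : S⟦X⟧),
      PowerSeries.mk (fun n => l (PowerSeries.coeff n (F * q))) =
        (f : R⟦X⟧) * PowerSeries.mk fun n => l (PowerSeries.coeff n q) := fun l q => by
    ext n
    simp only [PowerSeries.coeff_mk, PowerSeries.coeff_mul, map_sum, hF, PowerSeries.coeff_map]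
    refine Finset.sum_congr rfl fun ij _ => ?_
    rw [← Algebra.smul_def, map_smul, smul_eq_mul]
  constructor
  · intro g
    choose r hr using fun i => hW.1 (PowerSeries.mk fun n => e.repr (PowerSeries.coeff n g) i)
    choose q hq using hr
    refine ⟨∑ i, C (e i) * (r i).map (algebraMap R S),
      p' * ∑ i, PowerSeries.C (e i) * PowerSeries.map (algebraMap R S) (q i), ?_⟩
    rw [← mul_assoc, ← hpF, sub_eq_iff_eq_add]
    have hg : g = ∑ i, PowerSeries.C (e i) * PowerSeries.map (algebraMap R S)
        (PowerSeries.mk fun n => e.repr (PowerSeries.coeff n g) i) := by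
      ext n
      simp only [map_sum, PowerSeries.coeff_C_mul, PowerSeries.coeff_map, PowerSeries.coeff_mk]
      conv_lhs => rw [← e.sum_repr (PowerSeries.coeff n g)]
      exact Finset.sum_congr rfl fun i _ => by rw [Algebra.smul_def, mul_comm]
    have hsum : ((∑ i, C (e i) * (r i).map (algebraMap R S) : S[X]) : S⟦X⟧) =
        ∑ i, PowerSeries.C (e i) * PowerSeries.map (algebraMap R S) (r i) := by
      rw [← Polynomial.coeToPowerSeries.ringHom_apply, map_sum]
      refine Finset.sum_congr rfl fun i _ => ?_
      rw [Polynomial.coeToPowerSeries.ringHom_apply, Polynomial.coe_mul, Polynomial.coe_C,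
        polynomial_map_coe]
    rw [hsum, Finset.mul_sum, ← Finset.sum_add_distrib]
    conv_lhs => rw [hg]
    refine Finset.sum_congr rfl fun i _ => ?_
    rw [eq_add_of_sub_eq (hq i), map_add, map_mul]
    ring
  · rintro a ⟨q, hq⟩
    set P := a * p' with hP
    have hPF : (P : S⟦X⟧) = F * q := by
      rw [hP, Polynomial.coe_mul, hq, hpF]
      ring
    -- The coordinates of `a * p'` are polynomials that `f` divides.
    have hdvd : ∀ i, ∃ u : R[X], ∀ n, e.repr (P.coeff n) i = (f * u).coeff n := fun i => by
      set t := PowerSeries.trunc (P.natDegree + 1)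
        (PowerSeries.mk fun n => e.repr (P.coeff n) i) with ht
      have hcoeff : ∀ n, t.coeff n = e.repr (P.coeff n) i := fun n => by
        rw [ht, PowerSeries.coeff_trunc, PowerSeries.coeff_mk]
        split_ifs with hn
        · rfl
        · rw [coeff_eq_zero_of_natDegree_lt (by omega), map_zero, Finsupp.zero_apply]
      obtain ⟨u, hu⟩ := hW.2 t ⟨_, by
        rw [← hcoord (e.coord i) q, ← hPF]
        ext n
        rw [Polynomial.coeff_coe, hcoeff, PowerSeries.coeff_mk, Polynomial.coeff_coe]
        rfl⟩
      exact ⟨u, fun n => by rw [← hcoeff, hu]⟩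
    choose u hu using hdvd
    have hPu : P = f.map (algebraMap R S) * ∑ i, C (e i) * (u i).map (algebraMap R S) := by
      have h1 : P = ∑ i, C (e i) * (f * u i).map (algebraMap R S) := by
        ext n
        rw [finsetSum_coeff]
        conv_lhs => rw [← e.sum_repr (P.coeff n)]
        refine Finset.sum_congr rfl fun i _ => ?_
        rw [hu, coeff_C_mul, coeff_map, Algebra.smul_def, mul_comm]
      rw [h1, Finset.mul_sum]
      refine Finset.sum_congr rfl fun i _ => ?_
      rw [Polynomial.map_mul]
      ring
    -- Cancel `p'` from `a * p' = f * v` by multiplying with `p` and cancelling the monic `f`.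
    set v := ∑ i, C (e i) * (u i).map (algebraMap R S)
    refine ⟨v, (hf.map (algebraMap R S)).isRegular.left ?_⟩
    change _ * a = _ * (p * v)
    linear_combination a * hp' + p * hPu - p * hP

/-! ### The Vandermonde determinant -/

section Vandermonde

variable {A : Type*} [CommRing A] {k : ℕ} {b : Fin k → A} {y : Fin k → A}

open Matrix in
theorem eval_eq_vandermonde_mulVec_remCoeff (hb : monicPoly b = ∏ j, (X - C (y j))) (a : A[X])
    (l : Fin k) : a.eval (y l) = (vandermonde y *ᵥ remCoeff b a) l := by
  have h0 : (monicPoly b).eval (y l) = 0 := by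
    rw [hb, eval_prod]
    exact Finset.prod_eq_zero (Finset.mem_univ l) (by simp)
  obtain ⟨q, hq⟩ := dvd_sub_modByMonic b a
  have h1 := congrArg (eval (y l)) hq
  rw [eval_sub, eval_mul, h0, zero_mul, sub_eq_zero, ← sum_remCoeff] at h1
  rw [h1, eval_finsetSum, mulVec, dotProduct]
  refine Finset.sum_congr rfl fun j _ => ?_
  rw [eval_C_mul, eval_pow, eval_X, vandermonde_apply, mul_comm]

open Matrix in
theorem det_eval_eq_det_vandermonde_mul (hb : monicPoly b = ∏ j, (X - C (y j)))
    (a : Fin k → A[X]) :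
    (Matrix.of fun m l => (a m).eval (y l)).det =
      (vandermonde y).det * (Matrix.of fun m => remCoeff b (a m)).det := by
  rw [← det_transpose (Matrix.of fun m => remCoeff b (a m)), ← det_mul, ← det_transpose]
  congr 1
  ext l m
  exact eval_eq_vandermonde_mulVec_remCoeff hb (a m) l

open Matrix in
theorem det_vandermonde_mul_remCoeff_eq_zero (hb : monicPoly b = ∏ j, (X - C (y j))) {a : A[X]}
    (ha : ∀ l, a.eval (y l) = 0) (j : Fin k) : (vandermonde y).det * remCoeff b a j = 0 := by
  have h : vandermonde y *ᵥ remCoeff b a = 0 :=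
    funext fun l => (eval_eq_vandermonde_mulVec_remCoeff hb a l).symm.trans (ha l)
  have h2 := congrArg (fun v => adjugate (vandermonde y) *ᵥ v) h
  simp only [mulVec_mulVec, adjugate_mul, mulVec_zero, smul_mulVec, one_mulVec] at h2
  exact congrFun h2 j

end Vandermonde

/-! ### Exterior powers of free modules -/

section ExteriorPower

variable {R M : Type*} [CommRing R] [AddCommGroup M] [Module R M] {k : ℕ}

/-- The coordinate forms of a basis of the exterior power factor through antisymmetrization. -/
theorem toTensorPower_injective [Module.Free R M] :
    Function.Injective (exteriorPower.toTensorPower R M k) := by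
  classical
  obtain ⟨I, b⟩ := Module.Free.exists_basis R M
  let _ : LinearOrder I := linearOrderOfSTO WellOrderingRel
  rw [← LinearMap.ker_eq_bot, LinearMap.ker_eq_bot']
  intro z hz
  refine (b.exteriorPower k).ext_elem fun s => ?_
  rw [exteriorPower.basis_repr_apply, map_zero, Finsupp.zero_apply, exteriorPower.ιMultiDual,
    exteriorPower.ιMulti_family, exteriorPower.pairingDual,
    exteriorPower.alternatingMapLinearEquiv_apply_ιMulti]
  change TensorPower.multilinearMapToDual R M k _ (exteriorPower.toTensorPower R M k z) = 0
  rw [hz, map_zero]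

/-- The determinant identifies the top exterior power of a free module with the base ring. -/
def topExteriorEquiv (b : Module.Basis (Fin k) R M) : (⋀[R]^k M) ≃ₗ[R] R :=
  LinearEquiv.ofLinearMap (exteriorPower.alternatingMapLinearEquiv b.det)
    (LinearMap.toSpanSingleton R _ (exteriorPower.ιMulti R k b))
    (by
      ext
      simp only [LinearMap.comp_apply, LinearMap.toSpanSingleton_apply, one_smul,
        exteriorPower.alternatingMapLinearEquiv_apply_ιMulti, b.det_self, LinearMap.id_apply])
    (by
      refine exteriorPower.linearMap_ext (Module.Basis.ext_alternating b fun v hv => ?_)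
      obtain ⟨σ, rfl⟩ : ∃ σ : Equiv.Perm (Fin k), v = σ :=
        ⟨Equiv.ofBijective v (Finite.injective_iff_bijective.1 hv), rfl⟩
      simp only [LinearMap.compAlternatingMap_apply, LinearMap.comp_apply,
        exteriorPower.alternatingMapLinearEquiv_apply_ιMulti, LinearMap.toSpanSingleton_apply,
        LinearMap.id_apply]
      change b.det (b ∘ σ) • _ = exteriorPower.ιMulti R k (b ∘ σ)
      rw [AlternatingMap.map_perm, AlternatingMap.map_perm, b.det_self, Units.smul_def,
        Units.smul_def]
      rcases Int.units_eq_one_or (Equiv.Perm.sign σ) with h | h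
      · rw [h, Units.val_one, one_zsmul, one_zsmul, one_smul]
      · rw [h, Units.val_neg, Units.val_one, neg_one_zsmul, neg_one_zsmul]
        exact neg_one_smul R (_ : ⋀[R]^k M))

theorem topExteriorEquiv_ιMulti (b : Module.Basis (Fin k) R M) (v : Fin k → M) :
    topExteriorEquiv b (exteriorPower.ιMulti R k v) = b.det v :=
  exteriorPower.alternatingMapLinearEquiv_apply_ιMulti _ _

end ExteriorPower

namespace Divisor

variable {R : Type*} [CommRing R] [TopologicalSpace R] {G : FormalGroup R} {d : ℕ}
  (D : Divisor G d) (k : ℕ)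

/-! ### Symmetric elements of the tensor power -/

/-- The action of a permutation on `O_{D^k}` as an algebra map. -/
def permAlgHom (σ : Equiv.Perm (Fin k)) : D.PowRing k →ₐ[R] D.PowRing k :=
  AlgHom.ofLinearMap (PiTensorProduct.reindex R (fun _ : Fin k => D.ring) σ).toLinearMap
    (PiTensorProduct.reindex_tprod σ _) <| LinearMap.map_mul_iff _ |>.mpr <| by
      ext v w
      simp only [LinearMap.compMultilinearMap_apply, LinearMap.comp_apply, LinearMap.compr₂_apply,
        LinearMap.compl₂_apply, LinearMap.mul_apply', PiTensorProduct.tprod_mul_tprod,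
        LinearEquiv.coe_coe, PiTensorProduct.reindex_tprod]
      rfl

theorem isSymm_iff (s : D.PowRing k) : D.IsSymm k s ↔ ∀ σ, D.permAlgHom k σ s = s := Iff.rfl

theorem permAlgHom_tprod (σ : Equiv.Perm (Fin k)) (v : Fin k → D.ring) :
    D.permAlgHom k σ (PiTensorProduct.tprod R v) = PiTensorProduct.tprod R fun i => v (σ.symm i) :=
  PiTensorProduct.reindex_tprod σ v

theorem permAlgHom_xCoord (σ : Equiv.Perm (Fin k)) (j : Fin k) :
    D.permAlgHom k σ (D.xCoord k j) = D.xCoord k (σ j) := by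
  refine (D.permAlgHom_tprod k σ _).trans (congrArg (PiTensorProduct.tprod R) ?_)
  ext i
  simp only [MonoidHom.mulSingle_apply, Pi.mulSingle_apply, Equiv.symm_apply_eq]

theorem isSymm_coeff_pointsEqn (i : ℕ) : D.IsSymm k ((D.pointsEqn k).coeff i) := fun σ => by
  change D.permAlgHom k σ _ = _
  have h : (D.pointsEqn k).map (D.permAlgHom k σ : D.PowRing k →+* D.PowRing k) =
      D.pointsEqn k := by
    simp only [pointsEqn, Polynomial.map_prod, Polynomial.map_sub, map_X, map_C, RingHom.coe_coe,
      permAlgHom_xCoord]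
    exact Equiv.prod_comp σ fun j => X - C (D.xCoord k j)
  conv_rhs => rw [← h]
  rw [coeff_map]
  rfl

theorem toPoints_subCoeff (i : Fin k) : D.toPoints k (D.subCoeff k i) =
    Ideal.Quotient.mk (D.pointsIdeal k) ((D.pointsEqn k).coeff i) :=
  D.subLift_subCoeff _ _ i

/-- Every function on `Sub_k(D)` is represented by a symmetric element of `O_{D^k}`: the symmetric
polynomials in the `x_j` suffice. -/
theorem exists_isSymm_toPoints_eq (t : D.SubRing k) :
    ∃ s, D.IsSymm k s ∧ D.toPoints k t = Ideal.Quotient.mk (D.pointsIdeal k) s := by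
  obtain ⟨p, rfl⟩ : ∃ p, D.subMk k p = t := Ideal.Quotient.mk_surjective t
  refine ⟨MvPolynomial.aeval (fun i : Fin k => (D.pointsEqn k).coeff i) p, fun σ => ?_, ?_⟩
  · change D.permAlgHom k σ _ = _
    rw [← AlgHom.comp_apply, MvPolynomial.comp_aeval]
    congr 2
    exact funext fun i => D.isSymm_coeff_pointsEqn k i σ
  · change _ = Ideal.Quotient.mkₐ R (D.pointsIdeal k) _
    rw [← AlgHom.comp_apply, ← AlgHom.comp_apply]
    congr 1
    refine MvPolynomial.algHom_ext fun i => ?_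
    rw [AlgHom.comp_apply, AlgHom.comp_apply, MvPolynomial.aeval_X]
    exact D.toPoints_subCoeff k i

theorem mu_tprod (v : Fin k → D.ring) :
    D.mu k (PiTensorProduct.tprod R v) = exteriorPower.ιMulti R k v :=
  PiTensorProduct.lift.tprod _

theorem mu_surjective : Function.Surjective (D.mu k) := by
  rw [← LinearMap.range_eq_top, eq_top_iff, ← exteriorPower.ιMulti_span, Submodule.span_le]
  rintro _ ⟨v, rfl⟩
  exact ⟨_, D.mu_tprod k v⟩

theorem toTensorPower_mu (b : D.PowRing k) :
    exteriorPower.toTensorPower R D.ring k (D.mu k b) =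
      ∑ σ : Equiv.Perm (Fin k), Equiv.Perm.sign σ • D.permAlgHom k σ.symm b := by
  induction b using PiTensorProduct.induction_on with
  | smul_tprod r v =>
    rw [map_smul, map_smul, mu_tprod, exteriorPower.toTensorPower_apply_ιMulti, Finset.smul_sum]
    refine Finset.sum_congr rfl fun σ _ => ?_
    rw [map_smul, permAlgHom_tprod, smul_comm]
    rfl
  | add x y hx hy =>
    simp only [map_add, hx, hy, Units.smul_def, zsmul_add, Finset.sum_add_distrib]

theorem toTensorPower_mu_mul {s : D.PowRing k} (hs : D.IsSymm k s) (b : D.PowRing k) :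
    exteriorPower.toTensorPower R D.ring k (D.mu k (s * b)) =
      s * exteriorPower.toTensorPower R D.ring k (D.mu k b) := by
  rw [toTensorPower_mu, toTensorPower_mu, Finset.mul_sum]
  refine Finset.sum_congr rfl fun σ _ => ?_
  rw [map_mul, (D.isSymm_iff k s).1 hs, mul_smul_comm]

/-! ### Division by the Vandermonde determinant -/

theorem monicPoly_coeff_pointsEqn :
    monicPoly (fun i : Fin k => (D.pointsEqn k).coeff i) = D.pointsEqn k := by
  nontriviality D.PowRing k
  refine monicPoly_coeff_eq (D.monic_pointsEqn k) ?_
  rw [pointsEqn, natDegree_prod_of_monic _ _ fun _ _ => monic_X_sub_C _]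
  simp

theorem aeval_xCoord (j : Fin k) (p : R[X]) :
    aeval (D.xCoord k j) p = PiTensorProduct.singleAlgHom (R := R) (A := fun _ : Fin k => D.ring) j
      (aeval (CoordRing.mk D.eqn PowerSeries.X) p) :=
  aeval_algHom_apply (PiTensorProduct.singleAlgHom (R := R) (A := fun _ : Fin k => D.ring) j) _ p

theorem eval_eqn_xCoord (j : Fin k) :
    (D.eqn.map (algebraMap R (D.PowRing k))).eval (D.xCoord k j) = 0 := by
  rw [eval_map_algebraMap, aeval_xCoord, CoordRing.aeval_mk_X,
    (CoordRing.mk_eq_zero_iff _ _).2 dvd_rfl, map_zero]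

/-- The Vandermonde determinant of the points `x_j` annihilates the ideal `J_k`: the remainder of
`f_D` modulo `∏ (t - x_j)` vanishes at all the `x_j`. -/
theorem pointsIdeal_mul_det_vandermonde {s : D.PowRing k} (hs : s ∈ D.pointsIdeal k) :
    s * (Matrix.vandermonde (D.xCoord k)).det = 0 := by
  have h : ∀ n, (D.eqn.map (algebraMap R (D.PowRing k)) %ₘ D.pointsEqn k).coeff n *
      (Matrix.vandermonde (D.xCoord k)).det = 0 := fun n => by
    rw [← monicPoly_coeff_pointsEqn, ← sum_remCoeff, finsetSum_coeff, Finset.sum_mul]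
    refine Finset.sum_eq_zero fun j _ => ?_
    rw [coeff_C_mul, mul_right_comm, mul_comm (remCoeff _ _ _),
      det_vandermonde_mul_remCoeff_eq_zero (D.monicPoly_coeff_pointsEqn k) (D.eval_eqn_xCoord k),
      zero_mul]
  have hle : D.pointsIdeal k ≤
      LinearMap.ker (LinearMap.toSpanSingleton (D.PowRing k) (D.PowRing k)
        (Matrix.vandermonde (D.xCoord k)).det) :=
    Ideal.span_le.2 (Set.range_subset_iff.2 h)
  exact hle hs

/-- Multiplication by the Vandermonde determinant of the points `x_j`, as a map
`O_{P_k D} → O_{D^k}`. -/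
def mulVandermonde : D.PointsRing k →ₗ[D.PowRing k] D.PowRing k :=
  (D.pointsIdeal k).liftQ (LinearMap.toSpanSingleton (D.PowRing k) (D.PowRing k)
    (Matrix.vandermonde (D.xCoord k)).det) fun _ hs => D.pointsIdeal_mul_det_vandermonde k hs

theorem mulVandermonde_mk (s : D.PowRing k) :
    D.mulVandermonde k (Ideal.Quotient.mk _ s) = s * (Matrix.vandermonde (D.xCoord k)).det := rfl

theorem toTensorPower_ιMulti_eq_det (v : Fin k → D.ring) :
    exteriorPower.toTensorPower R D.ring k (exteriorPower.ιMulti R k v) =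
      (Matrix.of fun m l => PiTensorProduct.singleAlgHom (R := R) (A := fun _ : Fin k => D.ring) l
        (v m)).det := by
  rw [exteriorPower.toTensorPower_apply_ιMulti, Matrix.det_apply]
  refine Finset.sum_congr rfl fun σ _ => congrArg _ ?_
  change _ = ∏ l, PiTensorProduct.tprod R _
  rw [← PiTensorProduct.tprod_prod]
  congr 1
  exact (Finset.univ_prod_mulSingle _).symm

/-! ### The exterior power as the ring of subdivisors -/

/-- The basis `1, x, …, x ^ (d - 1)` of `O_D`. -/
def ringBasis (hW : WeierstrassDivision D.eqn) : Module.Basis (Fin d) R D.ring :=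
  Module.Basis.ofEquivFun (CoordRing.remEquiv D.lower hW)

theorem ringBasis_equivFun_aeval (hW : WeierstrassDivision D.eqn) (a : R[X]) :
    (D.ringBasis hW).equivFun (aeval (CoordRing.mk D.eqn PowerSeries.X) a) =
      remCoeff D.lower a :=
  (LinearEquiv.congr_fun (Module.Basis.equivFun_ofEquivFun (CoordRing.remEquiv D.lower hW))
    (aeval (CoordRing.mk D.eqn PowerSeries.X) a)).trans (CoordRing.remEquiv_aeval D.lower hW a)

/-- The map `O_D → O_{Sub_k(D)} ^ k` that sends a function on `D` to the coefficients of its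
remainder modulo the tautological equation. -/
def tautRem (hW : WeierstrassDivision D.eqn) : D.ring →ₗ[R] (Fin k → D.SubRing k) :=
  (D.ringBasis hW).constr R fun j : Fin d =>
    remCoeff (D.subCoeff k) (X ^ (j : ℕ))

theorem tautRem_aeval (hW : WeierstrassDivision D.eqn) (a : R[X]) :
    D.tautRem k hW (aeval (CoordRing.mk D.eqn PowerSeries.X) a) =
      remCoeff (D.subCoeff k) (a.map (algebraMap R (D.SubRing k))) := by
  have hdvd : monicPoly (D.subCoeff k) ∣ a.map (algebraMap R (D.SubRing k)) -
      (a %ₘ monicPoly D.lower).map (algebraMap R (D.SubRing k)) := by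
    rw [← Polynomial.map_sub]
    exact (D.tautEqn_dvd k).trans (Polynomial.map_dvd _ (dvd_sub_modByMonic D.lower a))
  rw [remCoeff_eq_of_dvd_sub hdvd, ← sum_remCoeff, tautRem, Module.Basis.constr_apply_fintype,
    Polynomial.map_sum, map_sum]
  refine Finset.sum_congr rfl fun j _ => ?_
  rw [ringBasis_equivFun_aeval, Polynomial.map_mul, map_C, Polynomial.map_pow, map_X,
    ← smul_eq_C_mul, map_smul, algebraMap_smul]

/-- The determinant of the remainders modulo the tautological equation, as a linear map
`⋀^k O_D → O_{Sub_k(D)}`. It is `phi` followed by the trivialization of `⋀^k O_{D'}` that is given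
by `1 ∧ x ∧ ⋯ ∧ x ^ (k - 1)`. -/
def tautDet (hW : WeierstrassDivision D.eqn) : (⋀[R]^k D.ring) →ₗ[R] D.SubRing k :=
  exteriorPower.alternatingMapLinearEquiv
    { ((Matrix.detRowAlternating (n := Fin k) (R := D.SubRing k)).toMultilinearMap.restrictScalars
        R).compLinearMap (fun _ => D.tautRem k hW) with
      map_eq_zero_of_eq' := fun v _ _ hv hij =>
        Matrix.detRowAlternating.map_eq_zero_of_eq (fun l => D.tautRem k hW (v l))
          (congrArg (D.tautRem k hW) hv) hij }

theorem tautDet_ιMulti (hW : WeierstrassDivision D.eqn) (v : Fin k → D.ring) :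
    D.tautDet k hW (exteriorPower.ιMulti R k v) =
      (Matrix.of fun l => D.tautRem k hW (v l)).det :=
  exteriorPower.alternatingMapLinearEquiv_apply_ιMulti _ _

theorem tautDet_ιMulti_aeval (hW : WeierstrassDivision D.eqn) (a : Fin k → R[X]) :
    D.tautDet k hW (exteriorPower.ιMulti R k fun l =>
        aeval (CoordRing.mk D.eqn PowerSeries.X) (a l)) =
      (Matrix.of fun l =>
        remCoeff (D.subCoeff k) ((a l).map (algebraMap R (D.SubRing k)))).det := by
  rw [tautDet_ιMulti]
  simp only [tautRem_aeval]

/-- The antisymmetrization of an element of `⋀^k O_D` is the Vandermonde determinant of the points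
`x_j` times its image in `O_{Sub_k(D)}`. -/
theorem toTensorPower_eq_mulVandermonde (hW : WeierstrassDivision D.eqn) (z : ⋀[R]^k D.ring) :
    exteriorPower.toTensorPower R D.ring k z =
      D.mulVandermonde k (D.toPoints k (D.tautDet k hW z)) := by
  suffices h : exteriorPower.toTensorPower R D.ring k =
      (D.mulVandermonde k).restrictScalars R ∘ₗ (D.toPoints k).toLinearMap ∘ₗ D.tautDet k hW from
    DFunLike.congr_fun h z
  refine exteriorPower.linearMap_ext (AlternatingMap.ext fun v => ?_)
  choose a ha using fun l => CoordRing.aeval_surjective hW (v l)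
  obtain rfl : (fun l => aeval (CoordRing.mk D.eqn PowerSeries.X) (a l)) = v := funext ha
  change exteriorPower.toTensorPower R D.ring k (exteriorPower.ιMulti R k _) =
    D.mulVandermonde k (D.toPoints k (D.tautDet k hW (exteriorPower.ιMulti R k _)))
  have h1 : D.toPoints k (D.tautDet k hW (exteriorPower.ιMulti R k fun l =>
      aeval (CoordRing.mk D.eqn PowerSeries.X) (a l))) = Ideal.Quotient.mk (D.pointsIdeal k)
        (Matrix.of fun l => remCoeff (fun i : Fin k => (D.pointsEqn k).coeff i)
          ((a l).map (algebraMap R (D.PowRing k)))).det := by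
    rw [tautDet_ιMulti_aeval, AlgHom.map_det, RingHom.map_det]
    refine congrArg Matrix.det ?_
    ext l j
    have hc : (fun i => (D.toPoints k : D.SubRing k →+* D.PointsRing k) (D.subCoeff k i)) =
        fun i : Fin k => Ideal.Quotient.mk (D.pointsIdeal k) ((D.pointsEqn k).coeff i) :=
      funext fun i => D.toPoints_subCoeff k i
    have h2 := remCoeff_map (D.toPoints k : D.SubRing k →+* D.PointsRing k) (D.subCoeff k)
      ((a l).map (algebraMap R (D.SubRing k))) j
    have h3 := remCoeff_map (Ideal.Quotient.mk (D.pointsIdeal k))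
      (fun i : Fin k => (D.pointsEqn k).coeff i) ((a l).map (algebraMap R (D.PowRing k))) j
    rw [Polynomial.map_map, AlgHom.comp_algebraMap, hc] at h2
    rw [Polynomial.map_map] at h3
    exact h2.symm.trans h3
  rw [h1, mulVandermonde_mk, mul_comm,
    ← det_eval_eq_det_vandermonde_mul (D.monicPoly_coeff_pointsEqn k), toTensorPower_ιMulti_eq_det]
  simp only [eval_map_algebraMap, aeval_xCoord]

theorem tautDet_injective (hW : WeierstrassDivision D.eqn) :
    Function.Injective (D.tautDet k hW) := by
  have : Module.Free R D.ring := Module.Free.of_basis (D.ringBasis hW)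
  intro z w h
  refine toTensorPower_injective ?_
  rw [toTensorPower_eq_mulVandermonde D k hW, h, ← toTensorPower_eq_mulVandermonde D k hW]

theorem subCoeff_mul_mem_range_tautDet (hW : WeierstrassDivision D.eqn) (i : Fin k)
    (z : ⋀[R]^k D.ring) : D.subCoeff k i * D.tautDet k hW z ∈ LinearMap.range (D.tautDet k hW) := by
  have hz : z ∈ Submodule.span R (Set.range (exteriorPower.ιMulti R k (M := D.ring))) := by
    rw [exteriorPower.ιMulti_span]
    trivial
  induction hz using Submodule.span_induction with
  | mem z hz =>
    obtain ⟨v, rfl⟩ := hz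
    choose a ha using fun l => CoordRing.aeval_surjective hW (v l)
    obtain rfl : (fun l => aeval (CoordRing.mk D.eqn PowerSeries.X) (a l)) = v := funext ha
    rw [tautDet_ιMulti_aeval, ← coeff_monicPoly (D.subCoeff k) i]
    refine coeff_mul_det_remCoeff_mem (D.subCoeff k) _
      (LinearMap.range (D.tautDet k hW)).toAddSubgroup (fun s => ?_) i
    refine ⟨exteriorPower.ιMulti R k fun l => aeval (CoordRing.mk D.eqn PowerSeries.X)
      (s.piecewise a (fun l => X * a l) l), ?_⟩
    rw [tautDet_ιMulti_aeval]
    refine congrArg Matrix.det (congrArg Matrix.of (funext fun l => congrArg _ ?_))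
    by_cases hl : l ∈ s <;> simp [hl]
  | zero => simp
  | add x y _ _ hx hy =>
    rw [map_add, mul_add]
    exact add_mem hx hy
  | smul r x _ hx =>
    rw [map_smul, mul_smul_comm]
    exact Submodule.smul_mem _ r hx

theorem tautDet_surjective (hW : WeierstrassDivision D.eqn) :
    Function.Surjective (D.tautDet k hW) := by
  have hmul : ∀ (p : MvPolynomial (Fin k) R) (z : ⋀[R]^k D.ring),
      D.subMk k p * D.tautDet k hW z ∈ LinearMap.range (D.tautDet k hW) := fun p => by
    induction p using MvPolynomial.induction_on with
    | C r =>
      intro z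
      rw [← MvPolynomial.algebraMap_eq, AlgHom.commutes, ← Algebra.smul_def, ← map_smul]
      exact ⟨_, rfl⟩
    | add p q hp hq =>
      intro z
      rw [map_add, add_mul]
      exact add_mem (hp z) (hq z)
    | mul_X p i hp =>
      intro z
      obtain ⟨w, hw⟩ := D.subCoeff_mul_mem_range_tautDet k hW i z
      rw [map_mul, mul_assoc]
      change _ * (D.subCoeff k i * _) ∈ _
      rw [← hw]
      exact hp w
  intro t
  obtain ⟨p, rfl⟩ : ∃ p, D.subMk k p = t := Ideal.Quotient.mk_surjective t
  have h1 : D.tautDet k hW (exteriorPower.ιMulti R k fun l : Fin k =>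
      aeval (CoordRing.mk D.eqn PowerSeries.X) (X ^ (l : ℕ) : R[X])) = 1 := by
    rw [tautDet_ιMulti_aeval, ← Matrix.det_one (n := Fin k)]
    refine congrArg Matrix.det ?_
    ext l j
    rw [Matrix.of_apply, Polynomial.map_pow, map_X, remCoeff_X_pow, Matrix.one_apply,
      Pi.single_apply]
    simp only [eq_comm]
  have h2 := hmul p (exteriorPower.ιMulti R k fun l : Fin k =>
      aeval (CoordRing.mk D.eqn PowerSeries.X) (X ^ (l : ℕ) : R[X]))
  rwa [h1, mul_one] at h2

/-- The exterior power of `O_D` is isomorphic to the ring of `Sub_k(D)`. -/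
def tautDetEquiv (hW : WeierstrassDivision D.eqn) : (⋀[R]^k D.ring) ≃ₗ[R] D.SubRing k :=
  LinearEquiv.ofBijective (D.tautDet k hW) ⟨D.tautDet_injective k hW, D.tautDet_surjective k hW⟩

/-- `O_{Sub_k(D)}` is free of finite rank over `R`, being isomorphic to `⋀^k O_D`, so that
Weierstrass division by `f_D` is inherited by `f_{D'}`. -/
theorem weierstrassDivision_tautEqn (hW : WeierstrassDivision D.eqn) :
    WeierstrassDivision (D.tautEqn k) :=
  hW.of_dvd_map (((D.ringBasis hW).exteriorPower k).map
    (D.tautDetEquiv k hW)) D.monic_eqn (D.tautEqn_dvd k)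

/-- The trivialization of `⋀^k O_{D'}` by `1 ∧ x ∧ ⋯ ∧ x ^ (k - 1)`. -/
def tautExteriorEquiv (hW : WeierstrassDivision D.eqn) :
    (⋀[D.SubRing k]^k (D.TautRing k)) ≃ₗ[D.SubRing k] D.SubRing k :=
  topExteriorEquiv (Module.Basis.ofEquivFun
    (CoordRing.remEquiv (D.subCoeff k) (D.weierstrassDivision_tautEqn k hW)))

theorem toTautRing_aeval (a : R[X]) :
    D.toTautRing k (aeval (CoordRing.mk D.eqn PowerSeries.X) a) =
      aeval (CoordRing.mk (D.tautEqn k) PowerSeries.X) (a.map (algebraMap R (D.SubRing k))) := by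
  have hX : D.toTautRing k (CoordRing.mk D.eqn PowerSeries.X) =
      CoordRing.mk (D.tautEqn k) PowerSeries.X := by
    exact congrArg (CoordRing.mk (D.tautEqn k))
      (PowerSeries.map_X (algebraMap R (D.SubRing k)))
  rw [← aeval_algHom_apply, hX, aeval_map_algebraMap]

theorem tautExteriorEquiv_phi (hW : WeierstrassDivision D.eqn) (z : ⋀[R]^k D.ring) :
    D.tautExteriorEquiv k hW (D.phi k z) = D.tautDet k hW z := by
  suffices h : (D.tautExteriorEquiv k hW).toLinearMap.restrictScalars R ∘ₗ D.phi k =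
      D.tautDet k hW from DFunLike.congr_fun h z
  refine exteriorPower.linearMap_ext (AlternatingMap.ext fun v => ?_)
  change D.tautExteriorEquiv k hW (D.phi k (exteriorPower.ιMulti R k v)) =
    D.tautDet k hW (exteriorPower.ιMulti R k v)
  rw [phi_ιMulti, tautDet_ιMulti, tautExteriorEquiv, topExteriorEquiv_ιMulti,
    Module.Basis.det_apply, ← Matrix.det_transpose]
  refine congrArg Matrix.det ?_
  ext l j
  obtain ⟨a, ha⟩ := CoordRing.aeval_surjective hW (v l)
  rw [Matrix.of_apply, ← ha, tautRem_aeval,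
    ← CoordRing.remEquiv_aeval (D.subCoeff k) (D.weierstrassDivision_tautEqn k hW),
    Matrix.transpose_apply, Module.Basis.toMatrix_apply, ← ha, toTautRing_aeval]
  rfl

/-- The `O_{Sub_k(D)}`-module structure on `⋀^k O_D` transported from `O_{Sub_k(D)}`. -/
@[reducible]
def exteriorModule (hW : WeierstrassDivision D.eqn) : Module (D.SubRing k) (⋀[R]^k D.ring) :=
  letI : SMul (D.SubRing k) (⋀[R]^k D.ring) :=
    ⟨fun t z => (D.tautDetEquiv k hW).symm (t * D.tautDet k hW z)⟩
  Function.Injective.module (D.SubRing k) (D.tautDet k hW).toAddMonoidHom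
    (D.tautDet_injective k hW) fun t z =>
      (D.tautDetEquiv k hW).apply_symm_apply (t * D.tautDet k hW z)

theorem tautDet_exteriorModule_smul (hW : WeierstrassDivision D.eqn) (t : D.SubRing k)
    (z : ⋀[R]^k D.ring) :
    D.tautDet k hW ((D.exteriorModule k hW).toSMul.smul t z) = t * D.tautDet k hW z :=
  (D.tautDetEquiv k hW).apply_symm_apply (t * D.tautDet k hW z)

/-- Both sides have the same antisymmetrization: `s` acts on antisymmetric tensors through its class
modulo `J_k`, which is the image of `t`. -/
theorem isNaturalModule_exteriorModule (hW : WeierstrassDivision D.eqn) :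
    D.IsNaturalModule k (D.exteriorModule k hW) := fun s t hs hst b => by
  have : Module.Free R D.ring := Module.Free.of_basis (D.ringBasis hW)
  refine toTensorPower_injective ?_
  rw [toTensorPower_mu_mul D k hs, toTensorPower_eq_mulVandermonde D k hW,
    tautDet_exteriorModule_smul, map_mul, hst, toTensorPower_eq_mulVandermonde D k hW (D.mu k b)]
  exact (D.mulVandermonde k).map_smul s _

variable {D k} in
theorem IsNaturalModule.unique {inst inst' : Module (D.SubRing k) (⋀[R]^k D.ring)}
    (h : D.IsNaturalModule k inst) (h' : D.IsNaturalModule k inst') : inst = inst' := by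
  refine Module.ext' _ _ fun t z => ?_
  obtain ⟨b, rfl⟩ := D.mu_surjective k z
  obtain ⟨s, hs, hst⟩ := D.exists_isSymm_toPoints_eq k t
  exact (h s t hs hst b).trans (h' s t hs hst b).symm

end Divisor

theorem free_and_finrank_eq_one {S M : Type*} [CommRing S] [AddCommGroup M] [Module S M]
    (e : M ≃ₗ[S] S) : Module.Free S M ∧ Module.finrank S M = 1 := by
  refine ⟨Module.Free.of_equiv e.symm, ?_⟩
  nontriviality S using Module.finrank_subsingleton
  rw [e.finrank_eq, Module.finrank_self]

end SubDiv

end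

theorem mainTheorem11 {R : Type*} [CommRing R] [UniformSpace R] [IsUniformAddGroup R]
    [IsTopologicalRing R] [IsLinearTopology R R] [T2Space R] [CompleteSpace R]
    (G : FormalGroup R) [G.IsComm] {d : ℕ} (D : SubDiv.Divisor G d) (k : ℕ) :
    ∃ inst : Module (D.SubRing k) (⋀[R]^k D.ring),
      (D.IsNaturalModule k inst ∧
        ∀ inst' : Module (D.SubRing k) (⋀[R]^k D.ring),
          D.IsNaturalModule k inst' → inst' = inst) ∧
      (∃ e : (⋀[R]^k D.ring) ≃ₗ[D.SubRing k] (⋀[D.SubRing k]^k (D.TautRing k)),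
        ∀ z, e z = D.phi k z) ∧
      (Module.Free (D.SubRing k) (⋀[R]^k D.ring) ∧
        Module.finrank (D.SubRing k) (⋀[R]^k D.ring) = 1) ∧
      (Module.Free (D.SubRing k) (⋀[D.SubRing k]^k (D.TautRing k)) ∧
        Module.finrank (D.SubRing k) (⋀[D.SubRing k]^k (D.TautRing k)) = 1) := by
  have hW : SubDiv.WeierstrassDivision D.eqn := SubDiv.weierstrassDivision_monicPoly D.nilp
  let inst := D.exteriorModule k hW
  have hnat : D.IsNaturalModule k inst := D.isNaturalModule_exteriorModule k hW
  let ψ : (⋀[R]^k D.ring) ≃ₗ[D.SubRing k] D.SubRing k :=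
    { D.tautDetEquiv k hW with map_smul' := D.tautDet_exteriorModule_smul k hW }
  let e := ψ.trans (D.tautExteriorEquiv k hW).symm
  refine ⟨inst, ⟨hnat, fun inst' h' => h'.unique hnat⟩, ⟨e, fun z => ?_⟩,
    SubDiv.free_and_finrank_eq_one ψ,
    SubDiv.free_and_finrank_eq_one (D.tautExteriorEquiv k hW)⟩
  exact (LinearEquiv.symm_apply_eq _).2 (D.tautExteriorEquiv_phi k hW z).symm
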